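/- Let $R$ be an associative ring with unit and let $I$ be an idempotent two-sided ideal of $R$. All modules are left $R$-modules. Let $(\mathcal{C}_I,\mathcal{T}_I,\mathcal{F}_I)$ be the TTF triple of $I$, that is, $\mathcal{C}_I=\{M : IM=M\}$, $\mathcal{T}_I=\{M : IM=0\}=\operatorname{Gen}(R/I)$ and $\mathcal{F}_I=\{M : \operatorname{Hom}_R(R/I,M)=0\}$, and let $\mathfrak{c}=(\mathcal{C}_I,\mathcal{T}_I)$; its torsion coradical is the functor $(1:\mathfrak{c})M=M/IM$. Let $j^*: R\text{-Mod}\to R\text{-Mod}/\mathcal{T}_I$ be the quotient functor and let $j_*: R\text{-Mod}/\mathcal{T}_I\to R\text{-Mod}$ be its right adjoint (these are the functors $j^*$, $j_*$ of the recollement of $R\text{-Mod}$ attached to the TTF triple). For a module $S$, $\operatorname{Gen}(S)$ is the class of the modules $M$ that admit an epimorphism $S^{(\alpha)}\to M$ for some set $\alpha$, and $S^{\perp_1}=\{M : \operatorname{Ext}^1_R(S,M)=0\}$. For a morphism $\sigma$, $\mathcal{D}_\sigma$ is the class of the modules $X$ such that $\operatorname{Hom}_R(\sigma,X)$ is surjective.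 Let $P_{-1}\xrightarrow{\sigma}P_0\to S\to 0$ be an exact sequence with $P_{-1},P_0$ projective, let $\pi_\sigma:P_{-1}\to\operatorname{Im}\sigma$ be the canonical epimorphism, and assume that $\operatorname{Gen}(S)=\mathcal{T}_I\subseteq S^{\perp_1}$. Then $S$ is silting with respect to $\sigma$ (that is, $\mathcal{D}_\sigma=\operatorname{Gen}(S)$) if and only if the following three conditions hold: (a) $(1:\mathfrak{c})\sigma:(1:\mathfrak{c})P_{-1}\to(1:\mathfrak{c})P_0$ is a split monomorphism; (b) $(1:\mathfrak{c})\pi_\sigma:(1:\mathfrak{c})P_{-1}\to(1:\mathfrak{c})\operatorname{Im}\sigma$ is an isomorphism; (c) for every object $D$ of $R\text{-Mod}/\mathcal{T}_I$, if $\operatorname{Hom}_R(\pi_\sigma,j_*D):\operatorname{Hom}_R(\operatorname{Im}\sigma,j_*D)\to\operatorname{Hom}_R(P_{-1},j_*D)$ is an isomorphism, then $D=0$. The same equivalence holds with "monomorphism" in place of "split monomorphism" in (a). -/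

import Mathlib

open CategoryTheory CategoryTheory.Limits

set_option linter.unusedSectionVars false

universe u

namespace SiltingTTF

noncomputable section

/-! ### Classes of modules attached to a module or to a morphism -/

section Classes

variable {R : Type u} [Ring R]

/-- `Gen S`: the modules `M` such that there is an epimorphism `S^(α) ⟶ M` for some set `α`. -/
def gen (S : ModuleCat.{u} R) : ObjectProperty (ModuleCat.{u} R) := fun M =>
  ∃ (α : Type u) (f : ModuleCat.of R (α →₀ S) ⟶ M), Epi f

/-- `S^{⊥₀}`: the modules `M` with `Hom(S, M) = 0`. -/
def perpZero (S : ModuleCat.{u} R) : ObjectProperty (ModuleCat.{u} R) := fun M =>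
  ∀ f : S ⟶ M, f = 0

/-- `S^{⊥₁}`: the modules `M` with `Ext¹(S, M) = 0`. -/
def perpOne (S : ModuleCat.{u} R) : ObjectProperty (ModuleCat.{u} R) := fun M =>
  Subsingleton (Abelian.Ext.{u} S M 1)

/-- `D_α`: the modules `X` such that `Hom(α, X)` is surjective. -/
def classD {A B : ModuleCat.{u} R} (a : A ⟶ B) : ObjectProperty (ModuleCat.{u} R) := fun X =>
  Function.Surjective (fun g : B ⟶ X => a ≫ g)

/-- `P₁ ⟶ P₀ ⟶ S ⟶ 0` is a projective presentation of `S`: the modules `P₁` and `P₀` are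
projective, the sequence is exact at `P₀`, and `P₀ ⟶ S` is surjective. -/
structure IsProjectivePresentation {P₁ P₀ S : ModuleCat.{u} R} (σ : P₁ ⟶ P₀) (p : P₀ ⟶ S) :
    Prop where
  projective₁ : Module.Projective R P₁
  projective₀ : Module.Projective R P₀
  exact : Function.Exact σ p
  surjective : Function.Surjective p

/-- `S` is silting with respect to `σ` if `D_σ = Gen S`. This is only used when `σ` is part of a
projective presentation of `S`, so that `S` is the cokernel of `σ`. -/
def IsSiltingWrt {P₁ P₀ : ModuleCat.{u} R} (S : ModuleCat.{u} R) (σ : P₁ ⟶ P₀) : Prop :=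
  classD σ = gen S

/-- The image of a morphism, as a module. -/
abbrev im {A B : ModuleCat.{u} R} (a : A ⟶ B) : ModuleCat.{u} R :=
  ModuleCat.of R (LinearMap.range a.hom)

/-- The canonical epimorphism `π_a : A ⟶ im a`. -/
abbrev toIm {A B : ModuleCat.{u} R} (a : A ⟶ B) : A ⟶ im a :=
  ModuleCat.ofHom a.hom.rangeRestrict

/-- A pair `(X, Y)` of classes of modules is a torsion pair if `X = ^{⊥₀}Y` and `Y = X^{⊥₀}`. -/
def IsTorsionPair (X Y : ObjectProperty (ModuleCat.{u} R)) : Prop :=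
  (∀ M, X M ↔ ∀ N, Y N → ∀ f : M ⟶ N, f = 0) ∧ (∀ N, Y N ↔ ∀ M, X M → ∀ f : M ⟶ N, f = 0)

end Classes

/-! ### The TTF triple of an idempotent two-sided ideal -/

section TTF

variable {R : Type u} [Ring R] (I : Ideal R)

/-- `C_I`: the modules `M` with `I M = M`. -/
def classC : ObjectProperty (ModuleCat.{u} R) := fun M => I • (⊤ : Submodule R M) = ⊤

/-- `T_I`: the modules `M` with `I M = 0`. -/
def classT : ObjectProperty (ModuleCat.{u} R) := fun M => I • (⊤ : Submodule R M) = ⊥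

/-- `F_I = (R/I)^{⊥₀}`. -/
def classF : ObjectProperty (ModuleCat.{u} R) := perpZero (ModuleCat.of R (R ⧸ I))

lemma smul_top_le_comap {M N : Type u} [AddCommGroup M] [Module R M] [AddCommGroup N] [Module R N]
    (f : M →ₗ[R] N) : I • (⊤ : Submodule R M) ≤ (I • (⊤ : Submodule R N)).comap f := by
  rw [Submodule.smul_le]
  intro r hr n _
  rw [Submodule.mem_comap, map_smul]
  exact Submodule.smul_mem_smul hr trivial

/-- The torsion coradical `(1 : c)` of the torsion pair `c = (C_I, T_I)`, sending `M` to `M / I M`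
(the torsion radical `c` sends `M` to its submodule `I M`). -/
def coradical : ModuleCat.{u} R ⥤ ModuleCat.{u} R where
  obj M := ModuleCat.of R (M ⧸ (I • (⊤ : Submodule R M)))
  map f := ModuleCat.ofHom (Submodule.mapQ _ _ f.hom (smul_top_le_comap I f.hom))
  map_id M := by
    ext x
    rfl
  map_comp f g := by
    ext x
    rfl

lemma classT_iff (M : ModuleCat.{u} R) : classT I M ↔ ∀ a ∈ I, ∀ m : M, a • m = 0 := by
  unfold classT
  rw [eq_bot_iff, Submodule.smul_le]
  exact ⟨fun h a ha m => by simpa using h a ha m trivial,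
    fun h a ha m _ => by simpa using h a ha m⟩

variable [I.IsTwoSided]

lemma classF_iff (M : ModuleCat.{u} R) :
    classF I M ↔ ∀ m : M, (∀ a ∈ I, a • m = 0) → m = 0 := by
  constructor
  · intro h m hm
    have h1 := h (ModuleCat.ofHom (Submodule.liftQ I (LinearMap.toSpanSingleton R M m)
      (fun a ha => by simpa using hm a ha)))
    have h2 := congrArg (fun f => f.hom (Submodule.Quotient.mk (1 : R))) h1
    change (1 : R) • m = 0 at h2
    simpa using h2
  · intro h f
    ext
    apply h
    intro a ha
    rw [← map_smul]
    have : Submodule.mkQ I (a • (1 : R)) = 0 := by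
      simpa [Ideal.Quotient.eq_zero_iff_mem] using ha
    rw [LinearMap.comp_apply, this, map_zero]

/-- `T_I = Gen (R/I)`. -/
theorem classT_eq_gen : classT I = gen (ModuleCat.of R (R ⧸ I)) := by
  ext M
  rw [classT_iff]
  constructor
  · intro h
    let f : (M →₀ (R ⧸ I)) →ₗ[R] M := Finsupp.lsum ℕ (fun m : M =>
      Submodule.liftQ I (LinearMap.toSpanSingleton R M m) (fun a ha => by simpa using h a ha m))
    refine ⟨M, ModuleCat.ofHom f, ?_⟩
    rw [ModuleCat.epi_iff_surjective]
    intro m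
    refine ⟨Finsupp.single m (Submodule.Quotient.mk (1 : R)), ?_⟩
    change f _ = _
    rw [Finsupp.lsum_single]
    exact one_smul R m
  · rintro ⟨α, f, hf⟩ a ha m
    rw [ModuleCat.epi_iff_surjective] at hf
    obtain ⟨x, rfl⟩ := hf m
    rw [← map_smul]
    have : a • x = 0 := by
      ext i
      obtain ⟨r, hr⟩ := Submodule.Quotient.mk_surjective I (x i)
      change a • x i = 0
      rw [← hr, ← Submodule.Quotient.mk_smul, Submodule.Quotient.mk_eq_zero]
      exact I.mul_mem_right r ha
    rw [this, map_zero]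

/-- The largest submodule of `M` annihilated by `I`. -/
def torsion (I : Ideal R) [I.IsTwoSided] (M : Type u) [AddCommGroup M] [Module R M] :
    Submodule R M where
  carrier := {m | ∀ a ∈ I, a • m = 0}
  add_mem' := fun hx hy a ha => by rw [smul_add, hx a ha, hy a ha, add_zero]
  zero_mem' := fun a _ => smul_zero a
  smul_mem' := fun r x hx a ha => by
    rw [← mul_smul]
    exact hx _ (I.mul_mem_right r ha)

section HomI

variable {I}

/-- `Hom_R(I, N)` as a left `R`-module, through the right multiplication of `R` on `I`. -/
def HomI (I : Ideal R) (N : Type u) [AddCommGroup N] [Module R N] : Type u := I →ₗ[R] N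

instance (N : Type u) [AddCommGroup N] [Module R N] : AddCommGroup (HomI I N) :=
  inferInstanceAs (AddCommGroup (I →ₗ[R] N))

/-- Right multiplication by `r` on `I`. -/
def mulRight (I : Ideal R) [I.IsTwoSided] (r : R) : I →ₗ[R] I where
  toFun x := ⟨x * r, I.mul_mem_right r x.2⟩
  map_add' x y := by
    ext
    simp [add_mul]
  map_smul' s x := by
    ext
    simp [mul_assoc]

instance (N : Type u) [AddCommGroup N] [Module R N] : Module R (HomI I N) where
  smul r f := LinearMap.comp (show I →ₗ[R] N from f) (mulRight I r)
  one_smul f := by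
    refine LinearMap.ext fun x => ?_
    exact congrArg (show I →ₗ[R] N from f) (Subtype.ext (mul_one x.1))
  mul_smul r s f := by
    refine LinearMap.ext fun x => ?_
    exact congrArg (show I →ₗ[R] N from f) (Subtype.ext (mul_assoc x.1 r s).symm)
  smul_zero r := rfl
  smul_add r f g := rfl
  add_smul r s f := by
    refine LinearMap.ext fun x => ?_
    have : mulRight I (r + s) x = mulRight I r x + mulRight I s x := Subtype.ext (mul_add x.1 r s)
    exact (congrArg (show I →ₗ[R] N from f) this).trans (map_add (show I →ₗ[R] N from f) _ _)
  zero_smul f := by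
    refine LinearMap.ext fun x => ?_
    have : mulRight I 0 x = 0 := Subtype.ext (mul_zero x.1)
    exact (congrArg (show I →ₗ[R] N from f) this).trans (map_zero (show I →ₗ[R] N from f))

variable {N : Type u} [AddCommGroup N] [Module R N]

/-- The underlying linear map of an element of `Hom_R(I, N)`. -/
def HomI.lin (f : HomI I N) : I →ₗ[R] N := f

/-- A linear map, as an element of `Hom_R(I, N)`. -/
def HomI.mk (f : I →ₗ[R] N) : HomI I N := f

@[simp]
lemma HomI.lin_mk (f : I →ₗ[R] N) : (HomI.mk f).lin = f := rfl

lemma HomI.ext {f g : HomI I N} (h : ∀ x, f.lin x = g.lin x) : f = g := LinearMap.ext h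

lemma HomI.smul_lin (r : R) (f : HomI I N) (x : I) :
    (r • f).lin x = f.lin ⟨x * r, I.mul_mem_right r x.2⟩ := rfl

lemma HomI.torsionFree (hN : ∀ n : N, (∀ a ∈ I, a • n = 0) → n = 0) (f : HomI I N)
    (h : ∀ a ∈ I, a • f = 0) : f = 0 := by
  refine HomI.ext fun x => ?_
  refine hN _ fun a ha => ?_
  rw [← map_smul]
  exact congrArg (fun g => g.lin ⟨a, ha⟩) (h x x.2)

/-- The linear map `x ↦ x m` from `I` to `M / t M`. -/
def reflectionFun (I : Ideal R) [I.IsTwoSided] {M : Type u} [AddCommGroup M] [Module R M] (m : M) :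
    HomI I (M ⧸ torsion I M) :=
  HomI.mk
    { toFun := fun x => (x : R) • (Submodule.Quotient.mk m : M ⧸ torsion I M)
      map_add' := fun _ _ => add_smul _ _ _
      map_smul' := fun _ _ => mul_smul _ _ _ }

/-- The canonical morphism from `M` to `Hom_R(I, M / t M)`. -/
def reflection (I : Ideal R) [I.IsTwoSided] (M : ModuleCat.{u} R) :
    M ⟶ ModuleCat.of R (HomI I (M ⧸ torsion I M)) :=
  ModuleCat.ofHom
    { toFun := reflectionFun I
      map_add' := fun m m' => HomI.ext fun x =>
        smul_add (x : R) (Submodule.Quotient.mk m : M ⧸ torsion I M) (Submodule.Quotient.mk m')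
      map_smul' := fun r m => HomI.ext fun x =>
        (mul_smul (x : R) r (Submodule.Quotient.mk m : M ⧸ torsion I M)).symm }

lemma reflection_lin (M : ModuleCat.{u} R) (m : M) (x : I) :
    HomI.lin (reflection I M m) x = (x : R) • (Submodule.Quotient.mk m : M ⧸ torsion I M) := rfl

end HomI

variable [hI : Fact (IsIdempotentElem I)]

lemma smul_eq_zero_of_mul {M : Type u} [AddCommGroup M] [Module R M] {m : M}
    (h : ∀ a ∈ I, ∀ b ∈ I, a • b • m = 0) : ∀ a ∈ I, a • m = 0 := by
  intro a ha
  rw [← hI.out.eq] at ha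
  refine Submodule.smul_induction_on (p := fun a => a • m = 0) ha ?_ ?_
  · intro x hx y hy
    rw [smul_eq_mul, mul_smul]
    exact h x hx y hy
  · intro x y hx hy
    rw [add_smul, hx, hy, add_zero]

/-- The modules `I M` and `M / I M` lie in `C_I` and `T_I`, that is, `0 → I M → M → M / I M → 0` is
the canonical sequence of `M` with respect to `(C_I, T_I)`. -/
theorem classC_radical_and_classT_coradical (M : ModuleCat.{u} R) :
    classC I (ModuleCat.of R (I • (⊤ : Submodule R M) : Submodule R M)) ∧
      classT I ((coradical I).obj M) := by
  constructor
  · unfold classC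
    have h : Submodule.map (Submodule.subtype (I • (⊤ : Submodule R M))) (I • ⊤) =
        Submodule.map (Submodule.subtype (I • (⊤ : Submodule R M))) ⊤ := by
      rw [Submodule.map_smul'', Submodule.map_top, Submodule.range_subtype, ← Submodule.mul_smul, hI.out.eq]
    exact Submodule.map_injective_of_injective (Submodule.subtype_injective _) h
  · rw [classT_iff]
    intro a ha m
    obtain ⟨m, rfl⟩ := Submodule.Quotient.mk_surjective _ m
    exact (Submodule.Quotient.mk_eq_zero _).2 (Submodule.smul_mem_smul ha trivial)

/-- `(C_I, T_I)` is a torsion pair. -/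
theorem isTorsionPair_c : IsTorsionPair (classC I) (classT I) := by
  have key : ∀ M N, classC I M → classT I N → ∀ f : M ⟶ N, f = 0 := by
    intro M N hM hN f
    ext m
    have : m ∈ I • (⊤ : Submodule R M) := by rw [hM]; trivial
    have := smul_top_le_comap I f.hom this
    rw [hN] at this
    simpa using this
  refine ⟨fun M => ⟨fun hM N hN => key M N hM hN, fun h => ?_⟩,
    fun N => ⟨fun hN M hM => key M N hM hN, fun h => ?_⟩⟩
  · have h1 := h _ (classC_radical_and_classT_coradical I M).2
      (ModuleCat.ofHom (Submodule.mkQ (I • (⊤ : Submodule R M))))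
    unfold classC
    rw [← Submodule.ker_mkQ (I • (⊤ : Submodule R M)), LinearMap.ker_eq_top]
    exact congrArg ModuleCat.Hom.hom h1
  · have h1 := h _ (classC_radical_and_classT_coradical I N).1
      (ModuleCat.ofHom (Submodule.subtype (I • (⊤ : Submodule R N))))
    have h2 : (I • (⊤ : Submodule R N)).subtype = 0 := congrArg ModuleCat.Hom.hom h1
    unfold classT
    rw [← Submodule.range_subtype (I • (⊤ : Submodule R N)), h2, LinearMap.range_zero]

/-- `(T_I, F_I)` is a torsion pair. -/
theorem isTorsionPair_t : IsTorsionPair (classT I) (classF I) := by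
  have key : ∀ M N, classT I M → classF I N → ∀ f : M ⟶ N, f = 0 := by
    intro M N hM hN f
    rw [classT_iff] at hM
    rw [classF_iff] at hN
    ext m
    refine hN _ (fun a ha => ?_)
    rw [← map_smul, hM a ha, map_zero]
  refine ⟨fun M => ⟨fun hM N hN => key M N hM hN, fun h => ?_⟩,
    fun N => ⟨fun hN M hM => key M N hM hN, fun h => ?_⟩⟩
  · let t := torsion I M
    have h1 := h (ModuleCat.of R (M ⧸ t)) (by
      rw [classF_iff]
      intro m hm
      obtain ⟨m, rfl⟩ := Submodule.Quotient.mk_surjective _ m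
      rw [Submodule.Quotient.mk_eq_zero]
      refine smul_eq_zero_of_mul I (fun a ha b hb => ?_)
      exact (Submodule.Quotient.mk_eq_zero t).1 (hm b hb) a ha) (ModuleCat.ofHom t.mkQ)
    rw [classT_iff]
    intro a ha m
    have h2 : t.mkQ m = 0 := congrArg (fun f => f.hom m) h1
    exact (Submodule.Quotient.mk_eq_zero t).1 h2 a ha
  · refine h _ ?_
    rw [classT_eq_gen]
    exact ⟨PUnit, ModuleCat.ofHom (Finsupp.lapply PUnit.unit), by
      rw [ModuleCat.epi_iff_surjective]
      intro x
      exact ⟨Finsupp.single PUnit.unit x, by simp⟩⟩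

/-! ### The quotient category `R-Mod / T_I` and the functors `j^*`, `j_*` of the recollement -/

/-- `T_I` is a Serre class. -/
instance : (classT I).IsSerreClass where
  exists_zero := ⟨ModuleCat.of R PUnit, ModuleCat.isZero_of_subsingleton _, by
    rw [classT_iff]
    intro a _ m
    rfl⟩
  prop_of_mono {X Y} f _ hY := by
    rw [classT_iff] at hY ⊢
    intro a ha m
    apply (ModuleCat.mono_iff_injective f).1 inferInstance
    rw [map_smul, hY a ha, map_zero]
  prop_of_epi {X Y} f _ hX := by
    rw [classT_iff] at hX ⊢
    intro a ha m
    obtain ⟨m, rfl⟩ := (ModuleCat.epi_iff_surjective f).1 inferInstance m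
    rw [← map_smul, hX a ha, map_zero]
  prop_X₂_of_shortExact {S} hS h₁ h₃ := by
    rw [classT_iff] at h₁ h₃ ⊢
    intro a ha m
    refine smul_eq_zero_of_mul I (fun a ha b hb => ?_) a ha
    have h : S.g (b • m) = 0 := by rw [map_smul, h₃ b hb]
    obtain ⟨x, hx⟩ := (ShortComplex.moduleCat_exact_iff S).1 hS.exact _ h
    rw [← hx, ← map_smul, h₁ a ha, map_zero]

/-- The quotient category `R-Mod / T_I`. -/
abbrev Quot : Type (u + 1) := (classT I).isoModSerre.Localization

/-- The quotient functor `j^* : R-Mod ⥤ R-Mod / T_I`. -/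
abbrev jUpperStar : ModuleCat.{u} R ⥤ Quot I := (classT I).isoModSerre.Q

section Reflection

variable {I} {N : Type u} [AddCommGroup N] [Module R N]

/-- If `N` is torsion-free, every linear map `I → Hom_R(I, N)` is of the form `a ↦ a g`. -/
lemma HomI.exists_smul_eq (hN : ∀ n : N, (∀ a ∈ I, a • n = 0) → n = 0)
    (φ : I →ₗ[R] HomI I N) : ∃ g : HomI I N, ∀ a : I, (a : R) • g = φ a := by
  have hφ : ∀ (x c : I) (r : R), (φ ⟨r * x, I.mul_mem_left r x.2⟩).lin c =
      (φ x).lin ⟨c * r, I.mul_mem_right r c.2⟩ := by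
    intro x c r
    have : (⟨r * x, I.mul_mem_left r x.2⟩ : I) = r • x := rfl
    rw [this, map_smul, HomI.smul_lin]
  have ex : ∀ x : I, ∃ n : N, ∀ c : I, (c : R) • n = (φ x).lin c := by
    rintro ⟨x, hx⟩
    have hx' := hx
    rw [← hI.out.eq] at hx'
    have : ∃ hx : x ∈ I, ∃ n : N, ∀ c : I, (c : R) • n = (φ ⟨x, hx⟩).lin c := by
      refine Submodule.smul_induction_on
        (p := fun x => ∃ hx : x ∈ I, ∃ n : N, ∀ c : I, (c : R) • n = (φ ⟨x, hx⟩).lin c) hx' ?_ ?_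
      · intro b hb a ha
        refine ⟨I.mul_mem_left b ha, (φ ⟨a, ha⟩).lin ⟨b, hb⟩, fun c => ?_⟩
        refine Eq.trans ?_ (hφ ⟨a, ha⟩ c b).symm
        rw [← map_smul]
        rfl
      · rintro x y ⟨hx, n, hn⟩ ⟨hy, m, hm⟩
        refine ⟨I.add_mem hx hy, n + m, fun c => ?_⟩
        have : (⟨x + y, I.add_mem hx hy⟩ : I) = ⟨x, hx⟩ + ⟨y, hy⟩ := rfl
        rw [smul_add, hn, hm, this, map_add]
        rfl
    exact this.2
  choose g hg using ex
  have uniq : ∀ n m : N, (∀ c : I, (c : R) • n = (c : R) • m) → n = m := by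
    intro n m h
    rw [← sub_eq_zero]
    refine hN _ fun a ha => ?_
    rw [smul_sub, h ⟨a, ha⟩, sub_self]
  let G : I →ₗ[R] N :=
    { toFun := g
      map_add' := fun x y => uniq _ _ fun c => by
        rw [smul_add, hg, hg, hg, map_add]
        rfl
      map_smul' := fun r x => uniq _ _ fun c => by
        rw [hg, RingHom.id_apply, ← mul_smul]
        have := hg x ⟨c * r, I.mul_mem_right r c.2⟩
        rw [this]
        exact hφ x c r }
  refine ⟨HomI.mk G, fun a => HomI.ext fun b => ?_⟩
  rw [HomI.smul_lin, HomI.lin_mk]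
  refine uniq _ _ fun c => ?_
  refine (hg _ c).trans ?_
  refine (hφ a c b).trans ?_
  rw [← map_smul]
  rfl

/-- If `N` is torsion-free, `Hom_R(I, N)` is right orthogonal to the morphisms whose kernel and
cokernel are annihilated by `I`. -/
lemma HomI.isLocal (hN : ∀ n : N, (∀ a ∈ I, a • n = 0) → n = 0) :
    (classT I).isoModSerre.isLocal (ModuleCat.of R (HomI I N)) := by
  intro X Y f hf
  have hk : ∀ x : X, f x = 0 → ∀ a ∈ I, a • x = 0 := by
    intro x hx a ha
    have h1 := (classT_iff I _).1 (show classT I (kernel f) from hf.1)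
    obtain ⟨z, rfl⟩ : ∃ z, kernel.ι f z = x := by
      have := (ShortComplex.moduleCat_exact_iff (ShortComplex.mk (kernel.ι f) f (by simp))).1
        (ShortComplex.exact_of_f_is_kernel _ (kernelIsKernel f)) x hx
      exact this
    rw [← map_smul, h1 a ha, map_zero]
  have hc : ∀ y : Y, ∀ a ∈ I, ∃ x, f x = a • y := by
    intro y a ha
    have h1 := (classT_iff I _).1 (show classT I (cokernel f) from hf.2)
    have h2 : cokernel.π f (a • y) = 0 := by rw [map_smul, h1 a ha]
    exact (ShortComplex.moduleCat_exact_iff (ShortComplex.mk f (cokernel.π f) (by simp))).1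
        (ShortComplex.exact_of_g_is_cokernel _ (cokernelIsCokernel f)) _ h2
  have tf := HomI.torsionFree hN
  have uniq : ∀ n m : HomI I N, (∀ a ∈ I, a • n = a • m) → n = m := by
    intro n m h
    rw [← sub_eq_zero]
    refine tf _ fun a ha => ?_
    rw [smul_sub, h a ha, sub_self]
  constructor
  · intro g g' h
    ext y
    refine uniq _ _ fun a ha => ?_
    obtain ⟨x, hx⟩ := hc y a ha
    have h' : g (f x) = g' (f x) := congrArg (fun k => k.hom x) h
    rw [hx, map_smul, map_smul] at h'
    exact h'
  · intro h
    have hh : ∀ x x' : X, f x = f x' → h x = h x' := by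
      intro x x' e
      refine uniq _ _ fun a ha => ?_
      have h1 := hk (x - x') (by rw [map_sub, e, sub_self]) a ha
      rw [smul_sub, sub_eq_zero] at h1
      have h2 := congrArg h h1
      rw [map_smul, map_smul] at h2
      exact h2
    choose s hs using hc
    have ex : ∀ y : Y, ∃ g : HomI I N, ∀ a : I, (a : R) • g = h (s y a a.2) := by
      intro y
      refine HomI.exists_smul_eq hN
        { toFun := fun a => h (s y a a.2)
          map_add' := fun a b => ?_
          map_smul' := fun r a => ?_ }
      · rw [← map_add]
        refine hh _ _ ?_
        rw [map_add, hs, hs, hs, ← add_smul]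
        rfl
      · rw [← map_smul]
        refine hh _ _ ?_
        rw [map_smul, hs, hs, ← mul_smul]
        rfl
    choose g hg using ex
    refine ⟨ModuleCat.ofHom
      { toFun := g
        map_add' := fun y z => uniq _ _ fun a ha => ?_
        map_smul' := fun r y => uniq _ _ fun a ha => ?_ }, ?_⟩
    · rw [smul_add]
      rw [hg _ ⟨a, ha⟩, hg _ ⟨a, ha⟩, hg _ ⟨a, ha⟩, ← map_add]
      refine hh _ _ ?_
      rw [map_add, hs, hs, hs, smul_add]
    · rw [RingHom.id_apply, ← mul_smul, hg _ ⟨a, ha⟩, hg _ ⟨a * r, I.mul_mem_right r ha⟩]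
      refine hh _ _ ?_
      rw [hs, hs, mul_smul]
    · ext x
      refine uniq _ _ fun a ha => ?_
      refine (hg _ ⟨a, ha⟩).trans ?_
      have := hh (s (f x) a ha) (a • x) (by rw [hs, map_smul])
      rw [map_smul] at this
      exact this

lemma torsionFree_quotient (M : Type u) [AddCommGroup M] [Module R M] (n : M ⧸ torsion I M)
    (h : ∀ a ∈ I, a • n = 0) : n = 0 := by
  obtain ⟨m, rfl⟩ := Submodule.Quotient.mk_surjective _ n
  rw [Submodule.Quotient.mk_eq_zero]
  refine smul_eq_zero_of_mul I (fun a ha b hb => ?_)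
  exact (Submodule.Quotient.mk_eq_zero (torsion I M)).1 (h b hb) a ha

lemma reflection_mem (M : ModuleCat.{u} R) : (classT I).isoModSerre (reflection I M) := by
  constructor
  · refine (classT_iff I _).2 fun a ha z => ?_
    apply (ModuleCat.mono_iff_injective (kernel.ι (reflection I M))).1 inferInstance
    rw [map_smul, map_zero]
    have h0 : reflection I M (kernel.ι (reflection I M) z) = 0 :=
      congrArg (fun k => k.hom z) (kernel.condition (reflection I M))
    refine smul_eq_zero_of_mul I (fun a ha b hb => ?_) a ha
    have h1 := (reflection_lin M (kernel.ι (reflection I M) z) ⟨b, hb⟩).symm.trans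
      (congrArg (fun k => HomI.lin k ⟨b, hb⟩) h0)
    have h2 : (Submodule.Quotient.mk (b • (kernel.ι (reflection I M) z)) : M ⧸ torsion I M) = 0 :=
      h1
    exact (Submodule.Quotient.mk_eq_zero (torsion I M)).1 h2 a ha
  · refine (classT_iff I _).2 fun a ha z => ?_
    obtain ⟨f, rfl⟩ := (ModuleCat.epi_iff_surjective (cokernel.π (reflection I M))).1
      inferInstance z
    obtain ⟨m, hm⟩ := Submodule.Quotient.mk_surjective _ (HomI.lin f ⟨a, ha⟩)
    have h1 : a • f = reflection I M m := by
      refine HomI.ext fun x => ?_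
      rw [HomI.smul_lin, reflection_lin, hm, ← map_smul]
      rfl
    rw [← map_smul, h1]
    exact congrArg (fun k => k.hom m) (cokernel.condition (reflection I M))

end Reflection

/-- A localization functor has a fully faithful right adjoint if every object admits a morphism of
the class to a local object. -/
lemma exists_rightAdjoint_Q {C : Type*} [Category* C] (W : MorphismProperty C) [W.IsMultiplicative]
    [W.HasTwoOutOfThreeProperty] [W.RespectsIso]
    (h : ∀ X : C, ∃ (L : C) (η : X ⟶ L), W η ∧ W.isLocal L) :
    ∃ G : W.Localization ⥤ C, G.Full ∧ G.Faithful ∧ Nonempty (W.Q ⊣ G) := by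
  choose L η hη hL using h
  let P : ObjectProperty C := W.isLocal
  have : P.ι.IsRightAdjoint := by
    rw [isRightAdjoint_iff_hasInitial_structuredArrow]
    intro A
    have hu := fun B : StructuredArrow A P.ι => (B.right.property (η A) (hη A))
    refine IsInitial.hasInitial (X := StructuredArrow.mk (Y := (⟨L A, hL A⟩ : P.FullSubcategory))
      (S := A) (T := P.ι) (η A)) (IsInitial.ofUniqueHom (fun B => StructuredArrow.homMk
        (ObjectProperty.homMk ((hu B).2 B.hom).choose) ((hu B).2 B.hom).choose_spec) ?_)
    intro B m
    ext
    refine (hu B).1 ?_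
    refine Eq.trans ?_ ((hu B).2 B.hom).choose_spec.symm
    exact StructuredArrow.w m
  let adj := Adjunction.ofIsRightAdjoint P.ι
  have hP : (fun X => X ∈ Set.range P.ι.obj) = P := by
    ext X
    exact ⟨by rintro ⟨Y, rfl⟩; exact Y.property, fun hX => ⟨⟨X, hX⟩, rfl⟩⟩
  have hW : ObjectProperty.isLocal P = W := by
    refine le_antisymm ?_ (W.le_isLocal_isLocal)
    intro X Y f hf
    have hX := W.le_isLocal_isLocal _ (hη X)
    have hY := W.le_isLocal_isLocal _ (hη Y)
    obtain ⟨g, hg⟩ := (hX (L Y) (hL Y)).2 (f ≫ η Y)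
    have h1 : P.isLocal (η X ≫ g) := by
      change η X ≫ g = _ at hg
      rw [hg]
      exact P.isLocal.comp_mem _ _ hf hY
    have h2 : P.isLocal g := P.isLocal.of_precomp _ _ hX h1
    rw [ObjectProperty.isLocal_iff_isIso _ _ (hL X) (hL Y)] at h2
    have h3 : W (f ≫ η Y) := by
      change η X ≫ g = _ at hg
      rw [← hg]
      exact W.comp_mem _ _ (hη X) (W.of_isIso g)
    exact W.of_postcomp _ _ (hη Y) h3
  have hloc : P.ι.leftAdjoint.IsLocalization W := by
    have := ObjectProperty.isLocalization_isLocal adj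
    rwa [hP, hW] at this
  let e := Localization.uniq W.Q P.ι.leftAdjoint W
  exact ⟨e.functor ⋙ P.ι, inferInstance, inferInstance,
    ⟨(adj.comp e.symm.toAdjunction).ofNatIsoLeft
      (Localization.compUniqInverse W.Q P.ι.leftAdjoint W)⟩⟩

lemma exists_rightAdjoint_jUpperStar :
    ∃ G : Quot I ⥤ ModuleCat.{u} R, G.Full ∧ G.Faithful ∧ Nonempty (jUpperStar I ⊣ G) :=
  exists_rightAdjoint_Q _ fun M => ⟨_, reflection I M, reflection_mem M,
    HomI.isLocal (torsionFree_quotient M)⟩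

instance : (jUpperStar I).IsLeftAdjoint := by
  obtain ⟨G, -, -, ⟨adj⟩⟩ := exists_rightAdjoint_jUpperStar I
  exact adj.isLeftAdjoint

/-- The functor `j_* : R-Mod / T_I ⥤ R-Mod`, the right adjoint of the quotient functor `j^*`. -/
def jLowerStar : Quot I ⥤ ModuleCat.{u} R := (jUpperStar I).rightAdjoint

/-- The adjunction `j^* ⊣ j_*`. -/
def jAdjunction : jUpperStar I ⊣ jLowerStar I := Adjunction.ofIsLeftAdjoint (jUpperStar I)

/-- The functor `j_*` is fully faithful. -/
theorem jLowerStar_full_faithful : (jLowerStar I).Full ∧ (jLowerStar I).Faithful := by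
  obtain ⟨G, _, _, ⟨adj⟩⟩ := exists_rightAdjoint_jUpperStar I
  let i : G ≅ jLowerStar I := adj.rightAdjointUniq (jAdjunction I)
  exact ⟨Functor.Full.of_iso i, Functor.Faithful.of_iso i⟩

/-- The kernel of `j^*` is `T_I`. -/
theorem isZero_jUpperStar_obj_iff (M : ModuleCat.{u} R) :
    IsZero ((jUpperStar I).obj M) ↔ classT I M :=
  ObjectProperty.SerreClassLocalization.isZero_obj_iff (jUpperStar I) (classT I) M

end TTF

end

end SiltingTTF

namespace SiltingTTF

noncomputable section

/-! ### Projective presentations and extension of morphisms from the syzygy -/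

section Presentation

variable {R : Type u} [Ring R]

/-! Since `Gen S = T_I`, silting means `D_σ = T_I`. Factor `σ` as `π_σ` followed by the inclusion of
`Im σ` in `P₀`, whose cokernel is `S ∈ T_I`. The modules `j_* D` do not see this inclusion, so `j_*
D ∈ D_σ` exactly when `Hom(π_σ, j_* D)` is bijective (`classD_jLowerStar_obj_iff`). Hence (c) says
that `D_σ` contains no nonzero `j_* D`.

If `D_σ = T_I`, extending `P₁ ⟶ P₁ / I P₁` along `σ` gives the retraction in (a); (b) follows
because the coradical preserves epimorphisms; and `j_* D ∈ T_I` forces `D = 0`.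

Conversely, (b) and `Ext¹(S, T_I) = 0` give `T_I ⊆ D_σ` (`classT_le_classD`). For `X ∈ D_σ`, the
unit `X ⟶ j_* j^* X` has cokernel in `T_I ⊆ D_σ`, so projectivity puts `j_* j^* X` in `D_σ`
(`classD_of_cokernel`); then (c) gives `j^* X = 0`, that is, `X ∈ T_I`. Condition (a) plays no role
here, so either form of it gives the same equivalence. -/

lemma gen_self (S : ModuleCat.{u} R) : gen S S :=
  ⟨PUnit, ModuleCat.ofHom (Finsupp.lapply PUnit.unit), by
    rw [ModuleCat.epi_iff_surjective]
    intro x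
    exact ⟨Finsupp.single PUnit.unit x, by simp⟩⟩

/-- The inclusion of the image of a morphism. -/
abbrev imIncl {A B : ModuleCat.{u} R} (a : A ⟶ B) : im a ⟶ B :=
  ModuleCat.ofHom (LinearMap.range a.hom).subtype

lemma toIm_imIncl {A B : ModuleCat.{u} R} (a : A ⟶ B) : toIm a ≫ imIncl a = a := rfl

instance {A B : ModuleCat.{u} R} (a : A ⟶ B) : Mono (imIncl a) :=
  (ModuleCat.mono_iff_injective _).2 Subtype.val_injective

instance {A B : ModuleCat.{u} R} (a : A ⟶ B) : Epi (toIm a) :=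
  (ModuleCat.epi_iff_surjective _).2 a.hom.surjective_rangeRestrict

namespace IsProjectivePresentation

variable {P₁ P₀ S : ModuleCat.{u} R} {σ : P₁ ⟶ P₀} {p : P₀ ⟶ S}

lemma imIncl_comp (hσ : IsProjectivePresentation σ p) : imIncl σ ≫ p = 0 := by
  ext ⟨_, x, rfl⟩
  exact hσ.exact.apply_apply_eq_zero x

lemma shortExact (hσ : IsProjectivePresentation σ p) :
    (ShortComplex.mk (imIncl σ) p hσ.imIncl_comp).ShortExact where
  exact := (ShortComplex.moduleCat_exact_iff _).2 fun x hx => by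
    obtain ⟨y, rfl⟩ := (hσ.exact x).1 hx
    exact ⟨⟨_, y, rfl⟩, rfl⟩
  mono_f := inferInstanceAs (Mono (imIncl σ))
  epi_g := (ModuleCat.epi_iff_surjective p).2 hσ.surjective

/-- If `Ext¹(S, X) = 0`, morphisms to `X` extend from the first syzygy of `S` to `P₀`. -/
lemma exists_extension (hσ : IsProjectivePresentation σ p) {X : ModuleCat.{u} R}
    (hX : perpOne S X) (f : im σ ⟶ X) : ∃ g : P₀ ⟶ X, imIncl σ ≫ g = f := by
  have : Subsingleton (Abelian.Ext.{u} S X 1) := hX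
  -- The obstruction to extending `f` is its image under the connecting map to `Ext¹(S, X)`, which
  -- vanishes.
  obtain ⟨x, hx⟩ := Abelian.Ext.contravariant_sequence_exact₁ hσ.shortExact X
    (Abelian.Ext.mk₀ f) (n₁ := 1) rfl (Subsingleton.elim (α := Abelian.Ext.{u} S X 1) _ _)
  obtain ⟨g, rfl⟩ := (Abelian.Ext.mk₀_bijective _ _).2 x
  rw [Abelian.Ext.mk₀_comp_mk₀] at hx
  exact ⟨g, (Abelian.Ext.mk₀_bijective _ _).1 hx⟩

end IsProjectivePresentation

end Presentation

/-! ### The coradical and the modules `j_* D` -/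

section TTF

variable {R : Type u} [Ring R] (I : Ideal R)

/-- The canonical projection `M ⟶ M / I M`. -/
abbrev toCoradical (M : ModuleCat.{u} R) : M ⟶ (coradical I).obj M :=
  ModuleCat.ofHom (Submodule.mkQ (I • (⊤ : Submodule R M)))

lemma toCoradical_naturality {M N : ModuleCat.{u} R} (f : M ⟶ N) :
    toCoradical I M ≫ (coradical I).map f = f ≫ toCoradical I N := rfl

instance (M : ModuleCat.{u} R) : Epi (toCoradical I M) :=
  (ModuleCat.epi_iff_surjective _).2 (Submodule.mkQ_surjective _)

/-- Morphisms to a module annihilated by `I` factor through the coradical. -/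
lemma exists_toCoradical_comp_eq {M X : ModuleCat.{u} R} (hX : classT I X) (f : M ⟶ X) :
    ∃ g : (coradical I).obj M ⟶ X, toCoradical I M ≫ g = f := by
  refine ⟨ModuleCat.ofHom (Submodule.liftQ _ f.hom ?_), ?_⟩
  · refine (smul_top_le_comap I f.hom).trans ?_
    rw [hX]
    exact le_rfl
  · ext x
    rfl

instance {M N : ModuleCat.{u} R} (f : M ⟶ N) [Epi f] : Epi ((coradical I).map f) := by
  have : Epi (toCoradical I M ≫ (coradical I).map f) := by
    rw [toCoradical_naturality]
    infer_instance
  exact epi_of_epi (toCoradical I M) _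

/-- The map is the first factor of a monomorphism, hence mono; it is epi because the coradical
preserves epimorphisms. -/
lemma isIso_coradical_map_toIm {A B : ModuleCat.{u} R} (a : A ⟶ B)
    [Mono ((coradical I).map a)] : IsIso ((coradical I).map (toIm a)) := by
  have : Mono ((coradical I).map (toIm a) ≫ (coradical I).map (imIncl a)) := by
    rw [← Functor.map_comp, toIm_imIncl]
    infer_instance
  have := mono_of_mono ((coradical I).map (toIm a)) ((coradical I).map (imIncl a))
  exact isIso_of_mono_of_epi _

variable [I.IsTwoSided] [hI : Fact (IsIdempotentElem I)]

/-- The projection `A ⟶ A / I A` extends along `a`, and the extension factors through `B / I B`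
because its target is annihilated by `I`; this factor is the retraction. -/
lemma isSplitMono_coradical_map {A B : ModuleCat.{u} R} (a : A ⟶ B)
    (ha : classD a ((coradical I).obj A)) : IsSplitMono ((coradical I).map a) := by
  obtain ⟨g, hg⟩ := ha (toCoradical I A)
  obtain ⟨r, rfl⟩ := exists_toCoradical_comp_eq I (classC_radical_and_classT_coradical I A).2 g
  refine ⟨⟨r, ?_⟩⟩
  rw [← cancel_epi (toCoradical I A), ← Category.assoc, toCoradical_naturality, Category.assoc,
    Category.comp_id]
  exact hg

/-- The objects in the image of `j_*` are local for the isomorphisms modulo `T_I`. -/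
lemma isLocal_jLowerStar_obj (D : Quot I) :
    (classT I).isoModSerre.isLocal ((jLowerStar I).obj D) := by
  intro X Y f hf
  have : IsIso ((jUpperStar I).map f) := Localization.inverts _ (classT I).isoModSerre f hf
  -- Under the adjunction, precomposition with `f` becomes precomposition with the isomorphism `j^*
  -- f`.
  have h : (fun g : Y ⟶ (jLowerStar I).obj D => f ≫ g) =
      (jAdjunction I).homEquiv X D ∘ (asIso ((jUpperStar I).map f)).homFromEquiv.symm ∘
        ((jAdjunction I).homEquiv Y D).symm := by
    ext1 g
    simp [Adjunction.homEquiv_naturality_left]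
  rw [h]
  exact ((jAdjunction I).homEquiv X D).bijective.comp
    ((Equiv.bijective _).comp (Equiv.bijective _))

/-- As `j_*` is fully faithful, the counit `j^* j_* D ⟶ D` is an isomorphism, and `j^*` kills `T_I`.
-/
lemma isZero_of_classT_jLowerStar_obj (D : Quot I) (h : classT I ((jLowerStar I).obj D)) :
    IsZero D := by
  have := (jLowerStar_full_faithful I).1
  have := (jLowerStar_full_faithful I).2
  exact ((isZero_jUpperStar_obj_iff I _).2 h).of_iso (asIso ((jAdjunction I).counit.app D)).symm

/-- The cokernel of the unit `M ⟶ j_* j^* M` lies in `T_I`. -/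
lemma classT_cokernel_unit (M : ModuleCat.{u} R) :
    classT I (cokernel ((jAdjunction I).unit.app M)) := by
  have := (jLowerStar_full_faithful I).1
  have := (jLowerStar_full_faithful I).2
  -- Full faithfulness of `j_*` makes `j^*` invert the unit.
  have h : IsIso ((jUpperStar I).map ((jAdjunction I).unit.app M)) := inferInstance
  have h' : Epi ((jUpperStar I).map ((jAdjunction I).unit.app M)) := IsIso.epi_of_iso _
  exact (ObjectProperty.SerreClassLocalization.epi_map_iff (jUpperStar I) (classT I)
    ((jAdjunction I).unit.app M)).1 h'

/-! ### Membership in `D_σ` -/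

variable {I} {P₁ P₀ S : ModuleCat.{u} R} {σ : P₁ ⟶ P₀} {p : P₀ ⟶ S}

/-- If `S` is annihilated by `I`, the inclusion of its first syzygy is an isomorphism modulo
`T_I`. -/
lemma IsProjectivePresentation.isoModSerre_imIncl (hσ : IsProjectivePresentation σ p)
    (hS : classT I S) : (classT I).isoModSerre (imIncl σ) := by
  rw [ObjectProperty.isoModSerre_iff_of_mono]
  have : Epi p := hσ.shortExact.epi_g
  exact (classT I).prop_of_iso
    ((cokernelIsCokernel (imIncl σ)).coconePointUniqueUpToIso hσ.shortExact.gIsCokernel).symm hS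

/-- If `S` is annihilated by `I`, a module `j_* D` lies in `D_σ` if and only if `Hom(π_σ, j_* D)`
is an isomorphism. -/
lemma IsProjectivePresentation.classD_jLowerStar_obj_iff (hσ : IsProjectivePresentation σ p)
    (hS : classT I S) (D : Quot I) : classD σ ((jLowerStar I).obj D) ↔
      Function.Bijective (fun g : im σ ⟶ (jLowerStar I).obj D => toIm σ ≫ g) := by
  have hl := isLocal_jLowerStar_obj I D (imIncl σ) (hσ.isoModSerre_imIncl hS)
  constructor
  · refine fun h => ⟨fun _ _ e => (cancel_epi (toIm σ)).1 e, fun f => ?_⟩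
    obtain ⟨g, rfl⟩ := h f
    exact ⟨imIncl σ ≫ g, rfl⟩
  · intro h f
    obtain ⟨g, rfl⟩ := h.2 f
    obtain ⟨k, rfl⟩ := hl.2 g
    exact ⟨k, rfl⟩

/-- The class `D_σ` contains every module that receives a morphism from a module in `D_σ` with
cokernel in `D_σ`. -/
lemma IsProjectivePresentation.classD_of_cokernel (hσ : IsProjectivePresentation σ p)
    {X Y : ModuleCat.{u} R} (φ : X ⟶ Y) (hX : classD σ X) (hφ : classD σ (cokernel φ)) :
    classD σ Y := by
  intro f
  have := (IsProjective.iff_projective (R := R) P₁).1 hσ.projective₁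
  have := (IsProjective.iff_projective (R := R) P₀).1 hσ.projective₀
  obtain ⟨h, hh⟩ := hφ (f ≫ cokernel.π φ)
  have hex : (ShortComplex.mk φ (cokernel.π φ) (by simp)).Exact :=
    ShortComplex.exact_of_g_is_cokernel _ (cokernelIsCokernel φ)
  -- Correct `f` by a lift of `h`: the difference `f - σ ≫ h'` dies in the cokernel, so it lifts to
  -- `X` by projectivity of `P₁`, and the lift extends along `σ`. Only exactness at `Y` is needed,
  -- so `φ` may have a kernel.
  let h' : P₀ ⟶ Y := Projective.factorThru h (cokernel.π φ)
  have h0 : (f - σ ≫ h') ≫ cokernel.π φ = 0 := by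
    rw [Preadditive.sub_comp, Category.assoc, Projective.factorThru_comp, sub_eq_zero]
    exact hh.symm
  obtain ⟨k, hk⟩ := hX (hex.liftFromProjective (f - σ ≫ h') h0)
  refine ⟨h' + k ≫ φ, ?_⟩
  have hk' : σ ≫ k ≫ φ = f - σ ≫ h' := by
    rw [← hex.liftFromProjective_comp (f - σ ≫ h') h0, ← hk]
    simp
  change σ ≫ (h' + k ≫ φ) = f
  rw [Preadditive.comp_add, hk']
  abel

/-- If the coradical of `π_σ` is an isomorphism and `Ext¹(S, X) = 0` for every `X` in `T_I`, then
`T_I` is contained in `D_σ`. -/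
lemma IsProjectivePresentation.classT_le_classD (hσ : IsProjectivePresentation σ p)
    (hExt : classT I ≤ perpOne S) [IsIso ((coradical I).map (toIm σ))] :
    classT I ≤ classD σ := by
  intro X hX f
  obtain ⟨g, rfl⟩ := exists_toCoradical_comp_eq I hX f
  -- Inverting the coradical of `π_σ` makes the given map factor through `Im σ`; the vanishing of
  -- `Ext¹(S, X)` then extends it to `P₀`.
  obtain ⟨k, hk⟩ := hσ.exists_extension (hExt X hX)
    (toCoradical I (im σ) ≫ inv ((coradical I).map (toIm σ)) ≫ g)
  refine ⟨k, ?_⟩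
  change toIm σ ≫ imIncl σ ≫ k = _
  rw [hk, ← Category.assoc, ← toCoradical_naturality]
  simp

end TTF

end

end SiltingTTF

theorem mainTheorem4 {R : Type u} [Ring R]
    (I : Ideal R) [I.IsTwoSided] [Fact (IsIdempotentElem I)]
    {P₁ P₀ S : ModuleCat.{u} R} (σ : P₁ ⟶ P₀) (p : P₀ ⟶ S)
    (hσ : SiltingTTF.IsProjectivePresentation σ p)
    (hGen : SiltingTTF.gen S = SiltingTTF.classT I)
    (hExt : SiltingTTF.classT I ≤ SiltingTTF.perpOne S) :
    (SiltingTTF.IsSiltingWrt S σ ↔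
      (IsSplitMono ((SiltingTTF.coradical I).map σ) ∧
        IsIso ((SiltingTTF.coradical I).map (SiltingTTF.toIm σ)) ∧
        ∀ D : SiltingTTF.Quot I,
          Function.Bijective (fun g : SiltingTTF.im σ ⟶ (SiltingTTF.jLowerStar I).obj D =>
            SiltingTTF.toIm σ ≫ g) → IsZero D)) ∧
    (SiltingTTF.IsSiltingWrt S σ ↔
      (Mono ((SiltingTTF.coradical I).map σ) ∧
        IsIso ((SiltingTTF.coradical I).map (SiltingTTF.toIm σ)) ∧
        ∀ D : SiltingTTF.Quot I,
          Function.Bijective (fun g : SiltingTTF.im σ ⟶ (SiltingTTF.jLowerStar I).obj D =>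
            SiltingTTF.toIm σ ≫ g) → IsZero D)) := by
  have hS : SiltingTTF.classT I S := hGen ▸ SiltingTTF.gen_self S
  have mp (h : SiltingTTF.IsSiltingWrt S σ) :
      IsSplitMono ((SiltingTTF.coradical I).map σ) ∧
        IsIso ((SiltingTTF.coradical I).map (SiltingTTF.toIm σ)) ∧
        ∀ D : SiltingTTF.Quot I,
          Function.Bijective (fun g : SiltingTTF.im σ ⟶ (SiltingTTF.jLowerStar I).obj D =>
            SiltingTTF.toIm σ ≫ g) → IsZero D := by
    have hD : SiltingTTF.classD σ = SiltingTTF.classT I := h.trans hGen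
    have hsplit := SiltingTTF.isSplitMono_coradical_map I σ
      (hD ▸ (SiltingTTF.classC_radical_and_classT_coradical I P₁).2)
    refine ⟨hsplit, SiltingTTF.isIso_coradical_map_toIm I σ, fun D hb => ?_⟩
    refine SiltingTTF.isZero_of_classT_jLowerStar_obj I D ?_
    exact hD.le _ ((hσ.classD_jLowerStar_obj_iff hS D).2 hb)
  have mpr (hb : IsIso ((SiltingTTF.coradical I).map (SiltingTTF.toIm σ)))
      (hc : ∀ D : SiltingTTF.Quot I,
          Function.Bijective (fun g : SiltingTTF.im σ ⟶ (SiltingTTF.jLowerStar I).obj D =>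
            SiltingTTF.toIm σ ≫ g) → IsZero D) : SiltingTTF.IsSiltingWrt S σ := by
    have hle := hσ.classT_le_classD hExt
    refine (le_antisymm (fun X hX => ?_) hle).trans hGen.symm
    rw [← SiltingTTF.isZero_jUpperStar_obj_iff]
    -- Condition (c) is applied to `D = j^* X`.
    refine hc _ ((hσ.classD_jLowerStar_obj_iff hS _).1 ?_)
    exact hσ.classD_of_cokernel ((SiltingTTF.jAdjunction I).unit.app X) hX
      (hle _ (SiltingTTF.classT_cokernel_unit I X))
  refine ⟨⟨mp, fun h => mpr h.2.1 h.2.2⟩, ⟨fun h => ?_, fun h => mpr h.2.1 h.2.2⟩⟩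
  obtain ⟨ha, hb, hc⟩ := mp h
  exact ⟨inferInstance, hb, hc⟩
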